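/- Let $d \ge 0$ and let $P \subset \mathbb{R}^d$ be a $d$-dimensional convex polytope (the convex hull of finitely many points, with affine span $\mathbb{R}^d$). The faces of a convex set $Q\subseteq\mathbb{R}^d$ are the empty set and the sets of maximizers over $Q$ of linear functions (so that $Q$ itself is a face if it is nonempty), and $\dim\emptyset=-1$. For a nonempty face $F$ of $P$ let $\mathcal N(F;P)$ be the set of vectors $v$ such that $F$ is exactly the set of points of $P$ at which $\langle v,\cdot\rangle$ attains its maximum over $P$. Suppose that $P$ is perfectly centered, that is, $\operatorname{relint}(F)\cap\mathcal N(F;P)\neq\emptyset$ for every nonempty face $F$ of $P$ (including $F=P$). Let $P^*=\{y\in\mathbb{R}^d : \langle x,y\rangle\le 1 \text{ for all } x\in P\}$ be the dual polytope, and let $P+P^*$ be the Minkowski sum. Write $f_k(Q)$ for the number of $k$-dimensional faces of $Q$, and, for $S\subseteq\{-1,0,\dots,d\}$, write $f_S=f_S(P)$ for the number of chains of faces of $P$ (ordered by inclusion) in which the dimensions of the elements are exactly the elements of $S$; put $f_{i,j}=f_{\{i,j\}}$, so that $f_{i,i}=f_{\{i\}}$ is the number of $i$-dimensional faces of $P$.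 Then $$f_k(P+P^*)=\sum_{i=0}^{k} f_{i,\,i+d-1-k}\qquad\text{for all } k=0,\dots,d-1.$$ -/

import Mathlib

open scoped Pointwise

namespace PerfCentered

variable {E : Type*} [NormedAddCommGroup E] [InnerProductSpace ℝ E]

/-- A convex polytope: the convex hull of finitely many points. -/
def IsPolytope (P : Set E) : Prop :=
  ∃ s : Set E, s.Finite ∧ P = convexHull ℝ s

/-- Faces of a convex set: the sets of maximizers of linear functionals, together with the
empty set. (For the zero functional one gets the whole set.) -/
def IsFace (P F : Set E) : Prop := IsExposed ℝ P F

open Classical in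
/-- The affine dimension of a set, with `dim ∅ = -1`. -/
noncomputable def dim (F : Set E) : ℤ :=
  if F = ∅ then -1 else (Module.finrank ℝ (vectorSpan ℝ F) : ℤ)

/-- `f_k(P)`: the number of faces of dimension `k`. -/
noncomputable def fVector (P : Set E) (k : ℤ) : ℕ :=
  {F : Set E | IsFace P F ∧ dim F = k}.ncard

/-- `f_S(P)`: the number of chains of faces (with respect to inclusion) such that the dimensions
of the members of the chain are exactly the elements of `S`. -/
noncomputable def extendedFVector (P : Set E) (S : Set ℤ) : ℕ :=
  {C : Set (Set E) | (∀ F ∈ C, IsFace P F) ∧ IsChain (· ⊆ ·) C ∧ dim '' C = S}.ncard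

/-- The (relatively open) outer normal cone of a face `F` of `P`: the vectors whose linear
function is maximized over `P` exactly on `F`. -/
def normalCone (F P : Set E) : Set E :=
  {v | F = {x ∈ P | ∀ y ∈ P, inner ℝ v y ≤ inner ℝ v x}}

/-- Every nonempty face meets its normal cone in its relative interior. -/
def PerfectlyCentered (P : Set E) : Prop :=
  ∀ F : Set E, IsFace P F → F.Nonempty → (intrinsicInterior ℝ F ∩ normalCone F P).Nonempty

/-- The dual (polar) `P* = {y | ⟨x, y⟩ ≤ 1 for all x ∈ P}`. -/
def dual (P : Set E) : Set E :=
  {y | ∀ x ∈ P, inner ℝ x y ≤ 1}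

end PerfCentered

/-! A face of `P + P*` exposed by `v` is the sum of the faces of `P` and `P*` exposed by `v`, and it
determines both summands. For `v ≠ 0` the face of `P*` is dual to a proper face `G` of `P`: scale
`v` to a boundary point of `P` and take the smallest face `G` containing it. Perfect centering
forces the face `F` of `P` exposed by `v` to lie in `G` (`PerfectlyCentered.maxFace_subset_carrier`,
then `PerfectlyCentered.exists_maxFace_dual_eq`). Conversely, every nested pair `F ⊆ G ≠ P` with `F`
nonempty arises, from the midpoint of the centers of `F` and `G`
(`PerfectlyCentered.exists_maxFace_eq_dualFace`).

So proper nonempty faces of `P + P*` correspond to such pairs. Since `⟨x, y⟩ = 1` for `x ∈ F` and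
`y` in the dual face of `G`, the two summands span orthogonal directions, and the dimension is `dim
F + (d - 1 - dim G)`. Setting this equal to `k` gives `dim G = dim F + d - 1 - k`. -/

namespace PerfCentered

open Set Filter Topology

/-! ### Exposed faces, Minkowski sums and dimension -/

section Faces

variable {E : Type*} [NormedAddCommGroup E] [InnerProductSpace ℝ E]

/-- The set of maximizers over `P` of the linear function `⟨v, ·⟩`. -/
def maxFace (P : Set E) (v : E) : Set E :=
  {x ∈ P | ∀ y ∈ P, inner ℝ v y ≤ inner ℝ v x}

theorem mem_normalCone {F P : Set E} {v : E} : v ∈ normalCone F P ↔ F = maxFace P v := Iff.rfl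

theorem isFace_maxFace (P : Set E) (v : E) : IsFace P (maxFace P v) :=
  fun _ => ⟨innerSL ℝ v, rfl⟩

theorem maxFace_zero (P : Set E) : maxFace P (0 : E) = P := by
  ext x
  simp [maxFace]

theorem maxFace_smul (P : Set E) (v : E) {t : ℝ} (ht : 0 < t) :
    maxFace P (t • v) = maxFace P v := by
  ext x
  simp [maxFace, inner_smul_left, mul_le_mul_iff_right₀ ht]

theorem IsFace.exists_maxFace [CompleteSpace E] {P F : Set E} (h : IsFace P F)
    (hF : F.Nonempty) : ∃ v, F = maxFace P v := by
  obtain ⟨l, hl⟩ := h hF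
  refine ⟨(InnerProductSpace.toDual ℝ E).symm l, ?_⟩
  rw [hl]
  ext x
  simp [maxFace]

theorem inner_eq_of_mem_maxFace {P : Set E} {v x y : E} (hx : x ∈ maxFace P v)
    (hy : y ∈ maxFace P v) : inner ℝ v x = inner ℝ v y :=
  le_antisymm (hy.2 x hx.1) (hx.2 y hy.1)

theorem mem_maxFace_of_le {P : Set E} {v x y : E} (hx : x ∈ maxFace P v) (hy : y ∈ P)
    (h : inner ℝ v x ≤ inner ℝ v y) : y ∈ maxFace P v :=
  ⟨hy, fun z hz => (hx.2 z hz).trans h⟩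

/-- If two maximal faces meet, then a positive combination of the functionals exposes their
intersection. -/
theorem maxFace_combo {P : Set E} {v w : E} (h : (maxFace P v ∩ maxFace P w).Nonempty)
    {a b : ℝ} (ha : 0 < a) (hb : 0 < b) :
    maxFace P (a • v + b • w) = maxFace P v ∩ maxFace P w := by
  obtain ⟨z, hzv, hzw⟩ := h
  ext x
  constructor
  · intro hx
    have h1 := hx.2 z hzv.1
    have h2 := hzv.2 x hx.1
    have h3 := hzw.2 x hx.1
    simp only [inner_add_left, real_inner_smul_left] at h1
    refine ⟨mem_maxFace_of_le hzv hx.1 ?_, mem_maxFace_of_le hzw hx.1 ?_⟩ <;>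
    · by_contra! h4
      nlinarith [mul_le_mul_of_nonneg_left h2 ha.le, mul_le_mul_of_nonneg_left h3 hb.le]
  · rintro ⟨hv, hw⟩
    refine ⟨hv.1, fun y hy => ?_⟩
    simp only [inner_add_left, real_inner_smul_left]
    nlinarith [mul_le_mul_of_nonneg_left (hv.2 y hy) ha.le,
      mul_le_mul_of_nonneg_left (hw.2 y hy) hb.le]

theorem maxFace_add {P Q : Set E} {v : E} :
    maxFace (P + Q) v = maxFace P v + maxFace Q v := by
  ext z
  constructor
  · rintro ⟨hz, hmax⟩
    obtain ⟨x, hx, y, hy, rfl⟩ := mem_add.1 hz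
    refine mem_add.2 ⟨x, ⟨hx, fun x' hx' => ?_⟩, y, ⟨hy, fun y' hy' => ?_⟩, rfl⟩
    · have := hmax _ (add_mem_add hx' hy)
      simp only [inner_add_right] at this
      linarith
    · have := hmax _ (add_mem_add hx hy')
      simp only [inner_add_right] at this
      linarith
  · intro hz
    obtain ⟨x, hx, y, hy, rfl⟩ := mem_add.1 hz
    refine ⟨add_mem_add hx.1 hy.1, fun z' hz' => ?_⟩
    obtain ⟨x', hx', y', hy', rfl⟩ := mem_add.1 hz'
    simp only [inner_add_right]
    linarith [hx.2 x' hx', hy.2 y' hy']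

theorem maxFace_subset_of_add_subset {P Q : Set E} {v w : E} (hQ : (maxFace Q v).Nonempty)
    (h : maxFace P v + maxFace Q v ⊆ maxFace (P + Q) w) : maxFace P v ⊆ maxFace P w := by
  obtain ⟨y, hy⟩ := hQ
  intro x hx
  refine ⟨hx.1, fun x' hx' => ?_⟩
  have := (h (add_mem_add hx hy)).2 _ (add_mem_add hx' hy.1)
  simp only [inner_add_right] at this
  linarith

/-- The summands of a face of a Minkowski sum are determined by the face. -/
theorem maxFace_eq_of_add_eq {P Q : Set E} {v w : E} (hPv : (maxFace P v).Nonempty)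
    (hQv : (maxFace Q v).Nonempty) (hPw : (maxFace P w).Nonempty) (hQw : (maxFace Q w).Nonempty)
    (h : maxFace P v + maxFace Q v = maxFace P w + maxFace Q w) :
    maxFace P v = maxFace P w ∧ maxFace Q v = maxFace Q w := by
  constructor
  · exact Subset.antisymm (maxFace_subset_of_add_subset hQv (h.le.trans maxFace_add.ge))
      (maxFace_subset_of_add_subset hQw (h.ge.trans maxFace_add.ge))
  · rw [add_comm, add_comm (maxFace P w)] at h
    exact Subset.antisymm (maxFace_subset_of_add_subset hPv (h.le.trans maxFace_add.ge))
      (maxFace_subset_of_add_subset hPw (h.ge.trans maxFace_add.ge))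

/-- A functional constant on a set vanishes on the vectors spanned by the set. -/
theorem inner_eq_zero_of_mem_vectorSpan {F : Set E} {v : E}
    (h : ∀ x ∈ F, ∀ y ∈ F, inner ℝ v x = inner ℝ v y) {u : E} (hu : u ∈ vectorSpan ℝ F) :
    inner ℝ v u = 0 := by
  have hle : vectorSpan ℝ F ≤ (ℝ ∙ v)ᗮ := by
    rw [vectorSpan_def, Submodule.span_le]
    rintro _ ⟨x, hx, y, hy, rfl⟩
    simp only [SetLike.mem_coe, Submodule.mem_orthogonal_singleton_iff_inner_right, vsub_eq_sub,
      inner_sub_right, h x hx y hy, sub_self]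
  exact Submodule.mem_orthogonal_singleton_iff_inner_right.1 (hle hu)

theorem dim_of_nonempty {F : Set E} (hF : F.Nonempty) :
    dim F = Module.finrank ℝ (vectorSpan ℝ F) := by
  rw [dim, if_neg hF.ne_empty]

theorem nonempty_of_dim {F : Set E} {n : ℕ} (h : dim F = n) : F.Nonempty := by
  rw [nonempty_iff_ne_empty]
  rintro rfl
  simp [dim] at h

theorem dim_mono [FiniteDimensional ℝ E] {F G : Set E} (hF : F.Nonempty) (h : F ⊆ G) :
    dim F ≤ dim G := by
  rw [dim_of_nonempty hF, dim_of_nonempty (hF.mono h)]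
  exact_mod_cast Submodule.finrank_mono (vectorSpan_mono ℝ h)

/-- Equal dimensions give equal direction spaces, so a functional exposing `F` is constant on `G` as
well. -/
theorem eq_of_subset_of_dim_eq [FiniteDimensional ℝ E] {P F G : Set E} (hFf : IsFace P F)
    (hGf : IsFace P G) (hF : F.Nonempty) (h : F ⊆ G) (hdim : dim F = dim G) : F = G := by
  refine h.antisymm fun x hx => ?_
  obtain ⟨v, rfl⟩ := hFf.exists_maxFace hF
  obtain ⟨y, hy⟩ := hF
  rw [dim_of_nonempty ⟨y, hy⟩, dim_of_nonempty ⟨x, hx⟩] at hdim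
  have hspan := Submodule.eq_of_le_of_finrank_eq (vectorSpan_mono ℝ h) (by exact_mod_cast hdim)
  have hmem : x -ᵥ y ∈ vectorSpan ℝ (maxFace P v) := by
    rw [hspan]
    exact vsub_mem_vectorSpan ℝ hx (h hy)
  have := inner_eq_zero_of_mem_vectorSpan (fun _ ha _ hb => inner_eq_of_mem_maxFace ha hb) hmem
  rw [vsub_eq_sub, inner_sub_right] at this
  exact mem_maxFace_of_le hy (hGf.subset hx) (by linarith)

theorem IsFace.eq_convexHull {P F s : Set E} (hs : s.Finite) (hP : P = convexHull ℝ s)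
    (hF : IsFace P F) : F = convexHull ℝ (s ∩ F) := by
  have hPc : IsCompact P := hP ▸ hs.isCompact_convexHull ℝ
  have hPconv : Convex ℝ P := hP ▸ convex_convexHull ℝ s
  have hFconv : Convex ℝ F := IsExposed.convex hF hPconv
  refine Subset.antisymm ?_ (convexHull_min inter_subset_right hFconv)
  -- Extreme points of `F` are extreme in `P`, hence belong to the generating set; Krein–Milman then
  -- recovers `F`.
  have hsub : F.extremePoints ℝ ⊆ s ∩ F := by
    intro x hx
    have hxP := (IsExposed.isExtreme hF).extremePoints_subset_extremePoints hx
    rw [hP] at hxP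
    exact ⟨extremePoints_convexHull_subset hxP, hx.1⟩
  conv_lhs => rw [← closure_convexHull_extremePoints (IsExposed.isCompact hF hPc) hFconv]
  exact closure_minimal (convexHull_mono hsub)
    ((hs.subset inter_subset_left).isClosed_convexHull ℝ)

theorem IsPolytope.finite_setOf_isFace {P : Set E} (hP : IsPolytope P) :
    {F | IsFace P F}.Finite := by
  obtain ⟨s, hs, hPs⟩ := hP
  refine (hs.finite_subsets.image (convexHull ℝ)).subset fun F hF => ?_
  exact ⟨s ∩ F, inter_subset_left, (IsFace.eq_convexHull hs hPs hF).symm⟩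

end Faces

/-! ### Relative interiors -/

section Relint

variable {E : Type*} [NormedAddCommGroup E] [InnerProductSpace ℝ E]

theorem eventually_add_smul_mem_of_mem_intrinsicInterior {G : Set E} {q u : E}
    (hq : q ∈ intrinsicInterior ℝ G) (hu : u ∈ vectorSpan ℝ G) :
    ∀ᶠ t : ℝ in 𝓝 0, q + t • u ∈ G := by
  obtain ⟨y, hy, rfl⟩ := mem_intrinsicInterior.1 hq
  have hmem (t : ℝ) : (y : E) + t • u ∈ affineSpan ℝ G := by
    rw [add_comm]
    refine AffineSubspace.vadd_mem_of_mem_direction ?_ y.2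
    rw [direction_affineSpan]
    exact Submodule.smul_mem _ _ hu
  let f : ℝ → affineSpan ℝ G := fun t => ⟨(y : E) + t • u, hmem t⟩
  have hf : Continuous f := by
    refine Continuous.subtype_mk ?_ _
    fun_prop
  have hf0 : f 0 = y := by
    ext
    simp [f]
  have hnhds : (fun x : affineSpan ℝ G => (x : E)) ⁻¹' G ∈ 𝓝 (f 0) := by
    rw [hf0]
    exact mem_interior_iff_mem_nhds.1 hy
  exact hf.continuousAt.eventually hnhds

theorem intrinsicInterior_subset_interior {G : Set E} (hG : affineSpan ℝ G = ⊤) :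
    intrinsicInterior ℝ G ⊆ interior G := by
  have hopen : IsOpen ((affineSpan ℝ G : AffineSubspace ℝ E) : Set E) := by
    rw [hG]
    exact isOpen_univ
  refine interior_maximal intrinsicInterior_subset ?_
  exact hopen.isOpenMap_subtype_val _ isOpen_interior

end Relint

end PerfCentered

namespace PerfCentered

open Set Filter Topology

/-! ### Polarity and the half-space description of a polytope -/

section Dual

variable {E : Type*} [NormedAddCommGroup E] [InnerProductSpace ℝ E]

theorem zero_mem_dual (P : Set E) : (0 : E) ∈ dual P := fun x _ => by simp

theorem dual_anti {P Q : Set E} (h : P ⊆ Q) : dual Q ⊆ dual P := fun _ hy x hx => hy x (h hx)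

theorem convex_dual (P : Set E) : Convex ℝ (dual P) := by
  intro y hy z hz a b ha hb hab x hx
  rw [inner_add_right, real_inner_smul_right, real_inner_smul_right]
  nlinarith [mul_le_mul_of_nonneg_left (hy x hx) ha, mul_le_mul_of_nonneg_left (hz x hx) hb]

theorem isClosed_dual (P : Set E) : IsClosed (dual P) := by
  have : dual P = ⋂ x ∈ P, {y | inner ℝ x y ≤ 1} := by
    ext
    simp [dual]
  rw [this]
  exact isClosed_biInter fun x _ => isClosed_le (by fun_prop) continuous_const

theorem subset_dual_dual (P : Set E) : P ⊆ dual (dual P) := fun x hx y hy => by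
  rw [real_inner_comm]
  exact hy x hx

theorem dual_closure_convexHull (s : Set E) : dual (closure (convexHull ℝ s)) = dual s := by
  refine (dual_anti ((subset_convexHull ℝ s).trans subset_closure)).antisymm ?_
  have h : closure (convexHull ℝ s) ⊆ dual (dual s) :=
    closure_minimal (convexHull_min (subset_dual_dual s) (convex_dual _)) (isClosed_dual _)
  exact (subset_dual_dual _).trans (dual_anti h)

theorem dual_convexHull (s : Set E) : dual (convexHull ℝ s) = dual s := by
  refine (dual_anti (subset_convexHull ℝ s)).antisymm ?_
  rw [← dual_closure_convexHull s]
  exact dual_anti subset_closure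

/-- The bipolar theorem for sets containing the origin. -/
theorem dual_dual [CompleteSpace E] {P : Set E} (hconv : Convex ℝ P) (hcl : IsClosed P)
    (h0 : (0 : E) ∈ P) : dual (dual P) = P := by
  refine Subset.antisymm (fun x hx => ?_) (subset_dual_dual P)
  by_contra hxP
  obtain ⟨f, u, hu, hux⟩ := geometric_hahn_banach_closed_point hconv hcl hxP
  have hu0 : 0 < u := by simpa using hu 0 h0
  set y := u⁻¹ • (InnerProductSpace.toDual ℝ E).symm f with hy
  have hyd : y ∈ dual P := by
    intro z hz
    rw [real_inner_comm, hy, real_inner_smul_left, InnerProductSpace.toDual_symm_apply,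
      inv_mul_le_iff₀ hu0, mul_one]
    exact (hu z hz).le
  have := hx y hyd
  rw [hy, real_inner_smul_left, InnerProductSpace.toDual_symm_apply, inv_mul_le_iff₀ hu0,
    mul_one] at this
  exact absurd hux this.not_gt

theorem isCompact_dual [FiniteDimensional ℝ E] {P : Set E} (h0 : (0 : E) ∈ interior P) :
    IsCompact (dual P) := by
  refine Metric.isCompact_of_isClosed_isBounded (isClosed_dual P) ?_
  obtain ⟨r, hr, hball⟩ := Metric.nhds_basis_closedBall.mem_iff.1 (mem_interior_iff_mem_nhds.1 h0)
  refine (Metric.isBounded_closedBall (x := (0 : E)) (r := r⁻¹)).subset fun y hy => ?_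
  rw [mem_closedBall_zero_iff]
  rcases eq_or_ne y 0 with rfl | hy0
  · simpa using hr.le
  have hn : 0 < ‖y‖ := norm_pos_iff.2 hy0
  have hmem : (r * ‖y‖⁻¹) • y ∈ P := hball (by
    rw [mem_closedBall_zero_iff, norm_smul, Real.norm_of_nonneg (by positivity)]
    field_simp
    rfl)
  have := hy _ hmem
  rw [real_inner_smul_left, real_inner_self_eq_norm_sq] at this
  rw [← one_div, le_div_iff₀ hr]
  calc ‖y‖ * r = r * ‖y‖⁻¹ * ‖y‖ ^ 2 := by field_simp
    _ ≤ 1 := this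

/-- From a point of a polyhedron one can move a little in every direction that does not leave the
active half-spaces. -/
theorem eventually_add_smul_mem_dual {S : Set E} (hS : S.Finite) {y u : E} (hy : y ∈ dual S)
    (hu : ∀ x ∈ S, inner ℝ x y = 1 → inner ℝ x u ≤ 0) :
    ∀ᶠ t : ℝ in 𝓝[>] 0, y + t • u ∈ dual S := by
  have : ∀ᶠ t : ℝ in 𝓝[>] 0, ∀ x ∈ S, inner ℝ x (y + t • u) ≤ 1 := by
    rw [eventually_all_finite hS]
    intro x hx
    rcases (hy x hx).eq_or_lt with h | h
    · filter_upwards [self_mem_nhdsWithin] with t ht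
      rw [inner_add_right, h, real_inner_smul_right]
      have := mul_nonpos_of_nonneg_of_nonpos (le_of_lt (mem_Ioi.1 ht)) (hu x hx h)
      linarith
    · have hcont : Continuous fun t : ℝ => inner ℝ x (y + t • u) := by fun_prop
      have := hcont.continuousAt.eventually_lt (x₀ := (0 : ℝ)) continuousAt_const
        (show inner ℝ x (y + (0 : ℝ) • u) < 1 by simpa using h)
      exact (this.filter_mono nhdsWithin_le_nhds).mono fun t ht => ht.le
  exact this

/-- An extreme point is determined by its active constraints: if `y` and `z` share them, then `y ±
t(z - y)` is feasible for small `t > 0`, so `y` is a midpoint unless `z = y`. -/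
theorem finite_extremePoints_dual {s : Set E} (hs : s.Finite) :
    ((dual s).extremePoints ℝ).Finite := by
  refine Set.Finite.of_finite_image (f := fun y => {x ∈ s | inner ℝ x y = 1})
    (hs.finite_subsets.subset ?_) ?_
  · rintro _ ⟨y, -, rfl⟩
    exact sep_subset _ _
  · intro y hy z hz h
    simp only at h
    have hactive : ∀ x ∈ s, inner ℝ x y = 1 → inner ℝ x z = 1 := fun x hx hxy =>
      ((Set.ext_iff.1 h x).1 ⟨hx, hxy⟩).2
    have h1 := eventually_add_smul_mem_dual hs (u := z - y) hy.1 fun x hx hxy => by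
      rw [inner_sub_right, hactive x hx hxy, hxy, sub_self]
    have h2 := eventually_add_smul_mem_dual hs (u := -(z - y)) hy.1 fun x hx hxy => by
      rw [inner_neg_right, inner_sub_right, hactive x hx hxy, hxy, sub_self, neg_zero]
    obtain ⟨t, ⟨ht1, ht2⟩, ht⟩ := ((h1.and h2).and self_mem_nhdsWithin).exists
    have heq := hy.2 ht1 ht2 ⟨1 / 2, 1 / 2, by norm_num, by norm_num, by norm_num, by module⟩
    have : t • (z - y) = 0 := by simpa using heq
    rcases smul_eq_zero.1 this with h0 | h0
    · exact absurd h0 ht.ne'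
    · exact (sub_eq_zero.1 h0).symm

/-- A polytope containing the origin in its interior is a finite intersection of half-spaces. -/
theorem IsPolytope.exists_eq_dual [FiniteDimensional ℝ E] {P : Set E} (hP : IsPolytope P)
    (h0 : (0 : E) ∈ interior P) : ∃ T : Set E, T.Finite ∧ P = dual T := by
  obtain ⟨s, hs, rfl⟩ := hP
  -- Krein–Milman rebuilds the compact set `dual s` from its extreme points, and the bipolar theorem
  -- returns to `P`.
  refine ⟨(dual s).extremePoints ℝ, finite_extremePoints_dual hs, ?_⟩
  rw [← dual_closure_convexHull, closure_convexHull_extremePoints _ (convex_dual s),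
    ← dual_convexHull s, dual_dual (convex_convexHull ℝ s) (hs.isClosed_convexHull ℝ)
      (interior_subset h0)]
  rw [← dual_convexHull s]
  exact isCompact_dual h0

end Dual

/-! ### Smallest faces of polyhedra and the key inclusion -/

section Carrier

variable {E : Type*} [NormedAddCommGroup E] [InnerProductSpace ℝ E]

/-- The smallest face of the polyhedron `dual T` containing `v`. -/
def carrier (T : Set E) (v : E) : Set E :=
  {x ∈ dual T | ∀ y ∈ T, inner ℝ y v = 1 → inner ℝ y x = 1}

theorem mem_carrier_self {T : Set E} {v : E} (hv : v ∈ dual T) : v ∈ carrier T v :=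
  ⟨hv, fun _ _ h => h⟩

theorem carrier_subset_of_mem {T : Set E} {v w : E} (hw : w ∈ carrier T v) :
    carrier T w ⊆ carrier T v :=
  fun _ hx => ⟨hx.1, fun y hy hyv => hx.2 y hy (hw.2 y hy hyv)⟩

theorem isFace_carrier {T : Set E} (hT : T.Finite) {v : E} (hv : v ∈ dual T) :
    IsFace (dual T) (carrier T v) := by
  have hA : {y ∈ T | inner ℝ y v = 1}.Finite := hT.subset (sep_subset _ _)
  -- The sum of the constraints active at `v` exposes the carrier: equality of the sums forces
  -- equality in each term.
  have heq : carrier T v = maxFace (dual T) (∑ y ∈ hA.toFinset, y) := by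
    have hle : ∀ x ∈ dual T, ∀ y ∈ hA.toFinset, inner ℝ y x ≤ inner ℝ y v := fun x hx y hy => by
      rw [Finite.mem_toFinset] at hy
      exact (hx y hy.1).trans hy.2.ge
    ext x
    constructor
    · intro hx
      refine ⟨hx.1, fun z hz => ?_⟩
      rw [sum_inner, sum_inner]
      refine Finset.sum_le_sum fun y hy => (hle z hz y hy).trans ?_
      rw [Finite.mem_toFinset] at hy
      rw [hx.2 y hy.1 hy.2, hy.2]
    · intro hx
      have hsum := hx.2 v hv
      rw [sum_inner, sum_inner] at hsum
      have := (Finset.sum_eq_sum_iff_of_le (hle x hx.1)).1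
        ((Finset.sum_le_sum (hle x hx.1)).antisymm hsum)
      exact ⟨hx.1, fun y hy hyv => (this y (by simp [hy, hyv])).trans hyv⟩
  rw [heq]
  exact isFace_maxFace _ _

/-- A supporting functional of a polyhedron at `v` is constant on the carrier of `v`. -/
theorem inner_eq_one_of_mem_carrier {T : Set E} (hT : T.Finite) {v x y : E} (hv : v ∈ dual T)
    (hx : x ∈ carrier T v) (hy : y ∈ dual (dual T)) (hvy : inner ℝ v y = 1) :
    inner ℝ x y = 1 := by
  refine (hy x hx.1).antisymm ?_
  -- Constraints active at `v` are active at `x`, so the segment from `x` extends past `v`; if `⟨x,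
  -- y⟩ < 1`, then `y` would exceed `1` there.
  have h := eventually_add_smul_mem_dual hT (u := v - x) hv fun z hz hzv => by
    rw [inner_sub_right, hzv, hx.2 z hz hzv, sub_self]
  obtain ⟨t, ht, ht0⟩ := (h.and self_mem_nhdsWithin).exists
  have := hy _ ht
  rw [inner_add_left, hvy, real_inner_smul_left, inner_sub_left, hvy] at this
  have ht0 : 0 < t := ht0
  nlinarith

/-- On a compact polyhedron, the ray from `q` through `v` leaves at a point on a facet
hyperplane which it crosses transversally. -/
theorem exists_exit_point {T : Set E} (hT : T.Finite) (hc : IsCompact (dual T)) {q v : E}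
    (hv : v ∈ dual T) (hqv : q ≠ v) :
    ∃ s : ℝ, 1 ≤ s ∧ q + s • (v - q) ∈ dual T ∧
      ∃ y ∈ T, inner ℝ y (q + s • (v - q)) = 1 ∧ 0 < inner ℝ y (v - q) := by
  have hne : v - q ≠ 0 := sub_ne_zero.2 hqv.symm
  let f : ℝ → E := fun s => q + s • (v - q)
  have hf : Continuous f := by fun_prop
  have hK : IsCompact (f ⁻¹' dual T) := by
    refine Metric.isCompact_of_isClosed_isBounded ((isClosed_dual T).preimage hf) ?_
    obtain ⟨R, hR⟩ := hc.isBounded.exists_norm_le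
    refine (Metric.isBounded_closedBall (x := (0 : ℝ)) (r := (R + ‖q‖) / ‖v - q‖)).subset
      fun s hs => ?_
    rw [mem_closedBall_zero_iff, le_div_iff₀ (norm_pos_iff.2 hne), ← norm_smul]
    calc ‖s • (v - q)‖ = ‖f s - q‖ := by simp [f]
      _ ≤ ‖f s‖ + ‖q‖ := norm_sub_le _ _
      _ ≤ R + ‖q‖ := by gcongr; exact hR _ hs
  have h1 : (1 : ℝ) ∈ f ⁻¹' dual T := by simpa [f] using hv
  obtain ⟨s, hs, hmax⟩ := hK.exists_isMaxOn ⟨1, h1⟩ continuousOn_id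
  refine ⟨s, hmax h1, hs, ?_⟩
  by_contra! hcon
  obtain ⟨t, ht, ht0⟩ := ((eventually_add_smul_mem_dual hT hs hcon).and self_mem_nhdsWithin).exists
  have hst : s + t ∈ f ⁻¹' dual T := by
    have : f (s + t) = q + s • (v - q) + t • (v - q) := by simp only [f]; module
    rw [mem_preimage, this]
    exact ht
  have := hmax hst
  simp only [id_eq, mem_ofPred_eq] at this
  have ht0 : 0 < t := ht0
  linarith

/-- In a perfectly centered polytope, a vector of the polytope is maximized on a subset of the
smallest face containing it. -/
theorem PerfectlyCentered.maxFace_subset_carrier {T : Set E} (hT : T.Finite)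
    (hcpt : IsCompact (dual T)) (hc : PerfectlyCentered (dual T)) {v : E} (hv : v ∈ dual T) :
    maxFace (dual T) v ⊆ carrier T v := by
  -- Induction on the number of inactive constraints. With `q` the center of the carrier, the ray
  -- from `q` through `v` exits at a point `w` of the same carrier with strictly more active
  -- constraints.
  induction h : {y ∈ T | inner ℝ y v ≠ 1}.ncard using Nat.strong_induction_on generalizing v with
  | _ n ih =>
    subst h
    obtain ⟨q, hqi, hqn⟩ := hc (carrier T v) (isFace_carrier hT hv)
      (nonempty_of_mem (mem_carrier_self hv))
    rw [mem_normalCone] at hqn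
    have hq : q ∈ carrier T v := intrinsicInterior_subset hqi
    rcases eq_or_ne q v with rfl | hqv
    · exact hqn.ge
    obtain ⟨s, hs1, hw, y, hy, hyw, hyu⟩ := exists_exit_point hT hcpt hv hqv
    set w := q + s • (v - q) with hwdef
    have hwc : w ∈ carrier T v := by
      refine ⟨hw, fun z hz hzv => ?_⟩
      rw [hwdef, inner_add_right, real_inner_smul_right, inner_sub_right, hzv, hq.2 z hz hzv]
      ring
    have hlt : {y ∈ T | inner ℝ y w ≠ 1}.ncard < {y ∈ T | inner ℝ y v ≠ 1}.ncard := by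
      refine ncard_lt_ncard ?_ (hT.subset (sep_subset _ _))
      have hsub : {y ∈ T | inner ℝ y w ≠ 1} ⊆ {y ∈ T | inner ℝ y v ≠ 1} := fun z hz =>
        ⟨hz.1, fun hzv => hz.2 (hwc.2 z hz.1 hzv)⟩
      rw [ssubset_iff_of_subset hsub]
      refine ⟨y, ⟨hy, fun hyv => hyu.ne' ?_⟩, fun hyw' => hyw'.2 hyw⟩
      rw [inner_sub_right, hyv, hq.2 y hy hyv, sub_self]
    have hFw : maxFace (dual T) w ⊆ carrier T v := (ih _ hlt hw rfl).trans (carrier_subset_of_mem hwc)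
    rcases hs1.eq_or_lt with rfl | hs1
    · have : w = v := by rw [hwdef]; module
      rwa [this] at hFw
    have hs0 : 0 < s := by linarith
    -- As `v` lies strictly between `q` and `w`, it exposes the intersection of their faces once
    -- these meet; the face of `q` is the carrier, which contains the face of `w` by induction.
    have hvcomb : v = (1 - s⁻¹) • q + s⁻¹ • w := by
      rw [hwdef]
      match_scalars <;> field_simp
      ring
    have hne : (maxFace (dual T) w).Nonempty := by
      obtain ⟨z, hz, hzmax⟩ := hcpt.exists_isMaxOn ⟨v, hv⟩
        (f := fun x => inner ℝ w x) (by fun_prop)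
      exact ⟨z, hz, fun x hx => hzmax hx⟩
    have hqw : (maxFace (dual T) q ∩ maxFace (dual T) w).Nonempty := by
      rwa [← hqn, inter_eq_right.2 hFw]
    rw [hvcomb, maxFace_combo hqw (sub_pos.2 (inv_lt_one_of_one_lt₀ hs1)) (inv_pos.2 hs0), ← hqn,
      inter_eq_right.2 hFw, ← hvcomb]
    exact hFw

end Carrier

end PerfCentered

namespace PerfCentered

open Set Filter Topology

/-! ### Dual faces and simultaneous exposure -/

section DualFace

variable {E : Type*} [NormedAddCommGroup E] [InnerProductSpace ℝ E]

/-- The face of the dual corresponding to a face `G` of `P`. -/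
def dualFace (P G : Set E) : Set E :=
  {y ∈ dual P | ∀ x ∈ G, inner ℝ x y = 1}

theorem IsPolytope.isCompact {P : Set E} (hP : IsPolytope P) : IsCompact P := by
  obtain ⟨s, hs, rfl⟩ := hP
  exact hs.isCompact_convexHull ℝ

theorem IsPolytope.convex {P : Set E} (hP : IsPolytope P) : Convex ℝ P := by
  obtain ⟨s, hs, rfl⟩ := hP
  exact convex_convexHull ℝ s

theorem finrank_sup_of_isOrtho [FiniteDimensional ℝ E] {A B : Submodule ℝ E} (h : A ⟂ B) :
    Module.finrank ℝ ↥(A ⊔ B) = Module.finrank ℝ A + Module.finrank ℝ B := by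
  rw [← Submodule.finrank_sup_add_finrank_inf_eq, h.disjoint.eq_bot, finrank_bot, add_zero]

theorem vectorSpan_add_set {F K : Set E} (hF : F.Nonempty) (hK : K.Nonempty) :
    vectorSpan ℝ (F + K) = vectorSpan ℝ F ⊔ vectorSpan ℝ K := by
  apply le_antisymm
  · rw [vectorSpan_def, Submodule.span_le]
    rintro _ ⟨a, ha, b, hb, rfl⟩
    obtain ⟨x, hx, y, hy, rfl⟩ := mem_add.1 ha
    obtain ⟨x', hx', y', hy', rfl⟩ := mem_add.1 hb
    have : x + y -ᵥ (x' + y') = (x -ᵥ x') + (y -ᵥ y') := by simp only [vsub_eq_sub]; abel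
    rw [SetLike.mem_coe]
    simp only [this]
    exact Submodule.add_mem_sup (vsub_mem_vectorSpan ℝ hx hx') (vsub_mem_vectorSpan ℝ hy hy')
  · obtain ⟨x₀, hx₀⟩ := hF
    obtain ⟨y₀, hy₀⟩ := hK
    refine sup_le ?_ ?_
    · rw [vectorSpan_def, Submodule.span_le]
      rintro _ ⟨x, hx, x', hx', rfl⟩
      have := vsub_mem_vectorSpan ℝ (add_mem_add hx hy₀) (add_mem_add hx' hy₀)
      simpa using this
    · rw [vectorSpan_def, Submodule.span_le]
      rintro _ ⟨y, hy, y', hy', rfl⟩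
      have := vsub_mem_vectorSpan ℝ (add_mem_add hx₀ hy) (add_mem_add hx₀ hy')
      simpa using this

theorem dim_add_of_inner_eq [FiniteDimensional ℝ E] {F K : Set E} (hF : F.Nonempty)
    (hK : K.Nonempty) {c : ℝ} (h : ∀ x ∈ F, ∀ y ∈ K, inner ℝ x y = c) :
    dim (F + K) = dim F + dim K := by
  rw [dim_of_nonempty (hF.add hK), dim_of_nonempty hF, dim_of_nonempty hK,
    vectorSpan_add_set hF hK, finrank_sup_of_isOrtho, Nat.cast_add]
  rw [vectorSpan_def ℝ F, Submodule.isOrtho_iff_le, Submodule.span_le]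
  rintro _ ⟨x, hx, x', hx', rfl⟩
  refine (Submodule.mem_orthogonal' _ _).2 fun u hu => inner_eq_zero_of_mem_vectorSpan ?_ hu
  intro y hy y' hy'
  simp only [vsub_eq_sub, inner_sub_left, h x hx y hy, h x' hx' y hy, h x hx y' hy', h x' hx' y' hy']

theorem vectorSpan_eq_top_of_dim [FiniteDimensional ℝ E] {P : Set E} (hne : P.Nonempty)
    (hd : dim P = Module.finrank ℝ E) : vectorSpan ℝ P = ⊤ := by
  rw [dim_of_nonempty hne] at hd
  exact Submodule.eq_top_of_finrank_eq (by exact_mod_cast hd)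

/-- The center of `P` itself is constant as a functional on a full-dimensional set, so it is `0`. -/
theorem PerfectlyCentered.zero_mem_interior [FiniteDimensional ℝ E] {P : Set E}
    (hc : PerfectlyCentered P) (hne : P.Nonempty) (hd : dim P = Module.finrank ℝ E) :
    (0 : E) ∈ interior P := by
  have htop := vectorSpan_eq_top_of_dim hne hd
  obtain ⟨q, hqi, hqn⟩ := hc P (IsExposed.refl P) hne
  rw [mem_normalCone] at hqn
  have hq : inner ℝ q q = 0 := by
    refine inner_eq_zero_of_mem_vectorSpan (F := P) (fun x hx y hy => ?_) (htop ▸ Submodule.mem_top)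
    rw [hqn] at hx hy
    exact inner_eq_of_mem_maxFace hx hy
  rw [inner_self_eq_zero] at hq
  subst hq
  exact intrinsicInterior_subset_interior
    ((AffineSubspace.affineSpan_eq_top_iff_vectorSpan_eq_top_of_nonempty ℝ E E hne).2 htop) hqi

/-- The center of a proper face, and the point of the dual face on the ray through it. -/
theorem PerfectlyCentered.exists_center {P G : Set E} (hc : PerfectlyCentered P)
    (hG : IsFace P G) (hne : G.Nonempty) (hGP : G ≠ P) :
    ∃ q ∈ intrinsicInterior ℝ G, G = maxFace P q ∧ q ≠ 0 ∧
      (‖q‖ ^ 2)⁻¹ • q ∈ dualFace P G ∧ ∀ x ∈ P, inner ℝ x ((‖q‖ ^ 2)⁻¹ • q) = 1 → x ∈ G := by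
  obtain ⟨q, hqi, hqn⟩ := hc G hG hne
  rw [mem_normalCone] at hqn
  have hq0 : q ≠ 0 := by
    rintro rfl
    exact hGP (hqn.trans (maxFace_zero P))
  have hpos : 0 < ‖q‖ ^ 2 := by positivity
  have hqG : q ∈ maxFace P q := hqn ▸ intrinsicInterior_subset hqi
  refine ⟨q, hqi, hqn, hq0, ⟨fun x hx => ?_, fun x hx => ?_⟩, fun x hx h => ?_⟩
  · rw [real_inner_smul_right, inv_mul_le_iff₀ hpos, mul_one, real_inner_comm,
      ← real_inner_self_eq_norm_sq]
    exact hqG.2 x hx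
  · rw [hqn] at hx
    rw [real_inner_smul_right, real_inner_comm, inner_eq_of_mem_maxFace hx hqG,
      real_inner_self_eq_norm_sq, inv_mul_cancel₀ hpos.ne']
  · rw [real_inner_smul_right, inv_mul_eq_one₀ hpos.ne', real_inner_comm] at h
    rw [hqn]
    refine mem_maxFace_of_le hqG hx ?_
    rw [← h, real_inner_self_eq_norm_sq]

/-- The rescaled center of `G` is a point of its dual face that takes the value `1` on `P` only
within `G`. -/
theorem PerfectlyCentered.eq_of_dualFace_eq {P G G' : Set E} (hc : PerfectlyCentered P)
    (hG : IsFace P G) (hne : G.Nonempty) (hGP : G ≠ P) (hG' : IsFace P G') (hne' : G'.Nonempty)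
    (hGP' : G' ≠ P) (h : dualFace P G = dualFace P G') : G = G' := by
  obtain ⟨q, -, -, -, hq, hqG⟩ := hc.exists_center hG hne hGP
  obtain ⟨q', -, -, -, hq', hqG'⟩ := hc.exists_center hG' hne' hGP'
  refine Subset.antisymm (fun x hx => hqG' x (hG.subset hx) ?_)
    fun x hx => hqG x (hG'.subset hx) ?_
  · rw [← h] at hq'
    exact hq'.2 x hx
  · rw [h] at hq
    exact hq.2 x hx

/-- At the rescaled center of `G`, the only active generators of `P` are those in `G`, so small
moves orthogonal to `G` stay in the dual face. -/
theorem PerfectlyCentered.vectorSpan_dualFace {P G : Set E} (hc : PerfectlyCentered P)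
    (hP : IsPolytope P) (hG : IsFace P G) (hne : G.Nonempty) (hGP : G ≠ P) :
    vectorSpan ℝ (dualFace P G) = (Submodule.span ℝ G)ᗮ := by
  obtain ⟨q, -, -, -, hq, hqG⟩ := hc.exists_center hG hne hGP
  generalize (‖q‖ ^ 2)⁻¹ • q = y₀ at hq hqG
  apply le_antisymm
  · intro u hu
    have hle : Submodule.span ℝ G ≤ (ℝ ∙ u)ᗮ := by
      rw [Submodule.span_le]
      intro x hx
      rw [SetLike.mem_coe, Submodule.mem_orthogonal_singleton_iff_inner_left]
      exact inner_eq_zero_of_mem_vectorSpan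
        (fun y hy y' hy' => (hy.2 x hx).trans (hy'.2 x hx).symm) hu
    refine (Submodule.mem_orthogonal _ _).2 fun x hx => ?_
    exact Submodule.mem_orthogonal_singleton_iff_inner_left.1 (hle hx)
  · intro u hu
    have hxu : ∀ x ∈ G, inner ℝ x u = 0 := fun x hx =>
      (Submodule.mem_orthogonal _ _).1 hu x (Submodule.subset_span hx)
    obtain ⟨s, hs, rfl⟩ := hP
    have hy₀ : y₀ ∈ dual s := dual_convexHull s ▸ hq.1
    have hev := eventually_add_smul_mem_dual hs (u := u) hy₀ fun x hx hxy =>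
      (hxu x (hqG x (subset_convexHull ℝ s hx) hxy)).le
    obtain ⟨t, ht, ht0⟩ := (hev.and self_mem_nhdsWithin).exists
    have ht0 : 0 < t := ht0
    have hmem : y₀ + t • u ∈ dualFace (convexHull ℝ s) G := by
      refine ⟨(dual_convexHull s).symm ▸ ht, fun x hx => ?_⟩
      rw [inner_add_right, real_inner_smul_right, hxu x hx, hq.2 x hx, mul_zero, add_zero]
    have := vsub_mem_vectorSpan ℝ hmem hq
    rw [vsub_eq_sub, add_sub_cancel_left] at this
    exact (Submodule.smul_mem_iff _ ht0.ne').1 this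

theorem PerfectlyCentered.dim_dualFace [FiniteDimensional ℝ E] {P G : Set E}
    (hc : PerfectlyCentered P) (hP : IsPolytope P) (hG : IsFace P G) (hne : G.Nonempty)
    (hGP : G ≠ P) : dim (dualFace P G) = Module.finrank ℝ E - 1 - dim G := by
  obtain ⟨q, hqi, hqn, hq0, hq, -⟩ := hc.exists_center hG hne hGP
  have hqG : q ∈ G := intrinsicInterior_subset hqi
  -- The center `q` is nonzero and orthogonal to the directions of `G`, so the linear span has
  -- dimension `dim G + 1`.
  have hspan : Submodule.span ℝ G = vectorSpan ℝ G ⊔ ℝ ∙ q := by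
    apply le_antisymm
    · rw [Submodule.span_le]
      intro x hx
      rw [← sub_add_cancel x q]
      exact Submodule.add_mem_sup (vsub_mem_vectorSpan ℝ hx hqG) (Submodule.mem_span_singleton_self q)
    · refine sup_le ?_ ((Submodule.span_singleton_le_iff_mem _ _).2 (Submodule.subset_span hqG))
      rw [vectorSpan_def, Submodule.span_le]
      rintro _ ⟨x, hx, y, hy, rfl⟩
      exact Submodule.sub_mem _ (Submodule.subset_span hx) (Submodule.subset_span hy)
  have hortho : vectorSpan ℝ G ⟂ ℝ ∙ q := by
    intro u hu
    rw [Submodule.mem_orthogonal_singleton_iff_inner_right]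
    refine inner_eq_zero_of_mem_vectorSpan (fun x hx y hy => ?_) hu
    rw [hqn] at hx hy
    exact inner_eq_of_mem_maxFace hx hy
  have h1 := finrank_sup_of_isOrtho hortho
  have h2 := Submodule.finrank_add_finrank_orthogonal (Submodule.span ℝ G)
  rw [← hspan, finrank_span_singleton hq0] at h1
  rw [dim_of_nonempty ⟨_, hq⟩, dim_of_nonempty hne, hc.vectorSpan_dualFace hP hG hne hGP]
  omega

/-- Nested faces are exposed simultaneously by one functional. -/
theorem PerfectlyCentered.exists_maxFace_eq_dualFace {P F G : Set E} (hc : PerfectlyCentered P)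
    (hP : IsPolytope P) (hF : IsFace P F) (hFne : F.Nonempty) (hG : IsFace P G) (hGP : G ≠ P)
    (hFG : F ⊆ G) : ∃ v, F = maxFace P v ∧ dualFace P G = maxFace (dual P) v := by
  obtain ⟨p, hpi, hpn⟩ := hc F hF hFne
  rw [mem_normalCone] at hpn
  obtain ⟨q, hqi, hqn, -, hq, -⟩ := hc.exists_center hG (hFne.mono hFG) hGP
  have hpG : p ∈ G := hFG (intrinsicInterior_subset hpi)
  have hqG : q ∈ G := intrinsicInterior_subset hqi
  have hvG : (1 / 2 : ℝ) • p + (1 / 2 : ℝ) • q ∈ G :=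
    IsExposed.convex hG hP.convex hpG hqG (by norm_num) (by norm_num) (by norm_num)
  set v := (1 / 2 : ℝ) • p + (1 / 2 : ℝ) • q with hv
  refine ⟨v, ?_, ?_⟩
  · rw [hv, maxFace_combo ?_ (by norm_num) (by norm_num), ← hpn, ← hqn, inter_eq_left.2 hFG]
    rwa [← hpn, ← hqn, inter_eq_left.2 hFG]
  · ext y
    constructor
    · intro hy
      refine ⟨hy.1, fun z hz => ?_⟩
      rw [hy.2 v hvG]
      exact hz v (hG.subset hvG)
    · intro hy
      -- The rescaled `q` attains `1` at `v`. As `⟨p, y⟩` and `⟨q, y⟩` are at most `1`, both must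
      -- equal `1`.
      have hvy : 1 ≤ inner ℝ v y := by
        rw [← hq.2 v hvG]
        exact hy.2 _ hq.1
      rw [hv, inner_add_left, real_inner_smul_left, real_inner_smul_left] at hvy
      have hpy := hy.1 p (hG.subset hpG)
      have hqy := hy.1 q (hG.subset hqG)
      refine ⟨hy.1, fun x hx => (hy.1 x (hG.subset hx)).antisymm ?_⟩
      -- Since `q` is relatively interior, moving from it away from `x` stays in `G`, where `y ≤ 1`;
      -- this forces `⟨x, y⟩ ≥ 1`.
      have hev := (eventually_add_smul_mem_of_mem_intrinsicInterior hqi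
        (vsub_mem_vectorSpan ℝ hqG hx)).filter_mono (nhdsWithin_le_nhds (s := Ioi 0))
      obtain ⟨t, ht, ht0⟩ := (hev.and self_mem_nhdsWithin).exists
      have ht0 : 0 < t := ht0
      have := hy.1 _ (hG.subset ht)
      rw [vsub_eq_sub, inner_add_left, real_inner_smul_left, inner_sub_left] at this
      nlinarith

/-- Every nonzero functional exposes a face of `P` and the dual of a face containing it. -/
theorem PerfectlyCentered.exists_maxFace_dual_eq [FiniteDimensional ℝ E] {P : Set E}
    (hc : PerfectlyCentered P) (hP : IsPolytope P) (h0 : (0 : E) ∈ interior P) {v : E}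
    (hv : v ≠ 0) :
    ∃ G, IsFace P G ∧ G ≠ P ∧ maxFace P v ⊆ G ∧ maxFace (dual P) v = dualFace P G := by
  have hdc := isCompact_dual h0
  obtain ⟨z, hz, hzmax⟩ := hdc.exists_isMaxOn ⟨0, zero_mem_dual P⟩
    (f := fun y => inner ℝ v y) (by fun_prop)
  have hm : 0 < inner ℝ v z := by
    obtain ⟨R, hR⟩ := hP.isCompact.isBounded.exists_norm_le
    have hR0 : 0 ≤ R := (norm_nonneg _).trans (hR 0 (interior_subset h0))
    have hpos : 0 < (R + 1) * ‖v‖ := mul_pos (by linarith) (norm_pos_iff.2 hv)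
    have hmem : ((R + 1) * ‖v‖)⁻¹ • v ∈ dual P := by
      intro x hx
      rw [real_inner_smul_right, inv_mul_le_iff₀ hpos, mul_one]
      refine (real_inner_le_norm x v).trans ?_
      gcongr
      linarith [hR x hx]
    have := hzmax hmem
    simp only [mem_ofPred_eq, real_inner_smul_right] at this
    exact lt_of_lt_of_le (mul_pos (inv_pos.2 hpos) (real_inner_self_pos.2 hv)) this
  set m := inner ℝ v z with hmdef
  -- Dividing by the maximum over `P*` makes that maximum `1`, so `w` is in `P` by the bipolar
  -- theorem; its carrier is the required `G`.
  set w := m⁻¹ • v with hw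
  have hwz : inner ℝ w z = 1 := by
    rw [hw, real_inner_smul_left, ← hmdef, inv_mul_cancel₀ hm.ne']
  have hwmax : ∀ y ∈ dual P, inner ℝ w y ≤ 1 := by
    intro y hy
    rw [hw, real_inner_smul_left, inv_mul_le_iff₀ hm, mul_one]
    exact hzmax hy
  have hwP : w ∈ P := by
    rw [← dual_dual hP.convex hP.isCompact.isClosed (interior_subset h0)]
    intro y hy
    rw [real_inner_comm]
    exact hwmax y hy
  obtain ⟨T, hT, hPT⟩ := hP.exists_eq_dual h0
  rw [← maxFace_smul P v (inv_pos.2 hm), ← maxFace_smul (dual P) v (inv_pos.2 hm), ← hw]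
  have hzc : ∀ y ∈ dual P, inner ℝ w y = 1 → ∀ x ∈ carrier T w, inner ℝ x y = 1 := by
    intro y hy hwy x hx
    subst hPT
    exact inner_eq_one_of_mem_carrier hT hwP hx hy hwy
  refine ⟨carrier T w, ?_, ?_, ?_, ?_⟩
  · subst hPT
    exact isFace_carrier hT hwP
  · intro h
    have := hzc z hz hwz 0 (h ▸ interior_subset h0)
    simp at this
  · have hcpt := hP.isCompact
    subst hPT
    exact hc.maxFace_subset_carrier hT hcpt hwP
  · ext y
    constructor
    · intro hy
      exact ⟨hy.1, hzc y hy.1 ((hwmax y hy.1).antisymm (hwz ▸ hy.2 z hz))⟩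
    · intro hy
      refine ⟨hy.1, fun y' hy' => ?_⟩
      rw [hy.2 w (mem_carrier_self (hPT ▸ hwP))]
      exact hwmax y' hy'

end DualFace

/-! ### The bijection between faces of the sum and nested pairs -/

section Counting

variable {E : Type*} [NormedAddCommGroup E] [InnerProductSpace ℝ E]

/-- Pairs of nested faces of dimensions `i` and `j`. -/
def facePairs (P : Set E) (i j : ℤ) : Set (Set E × Set E) :=
  {p | IsFace P p.1 ∧ IsFace P p.2 ∧ p.1 ⊆ p.2 ∧ dim p.1 = i ∧ dim p.2 = j}

theorem IsPolytope.finite_facePairs {P : Set E} (hP : IsPolytope P) (i j : ℤ) :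
    (facePairs P i j).Finite :=
  (hP.finite_setOf_isFace.prod hP.finite_setOf_isFace).subset fun _ hp => ⟨hp.1, hp.2.1⟩

/-- Nested nonempty faces of equal dimension coincide, so a chain has one member per dimension. This
also covers `i = j`, where the pair collapses to a single face. -/
theorem extendedFVector_pair [FiniteDimensional ℝ E] (P : Set E) (i : ℕ) {j : ℤ}
    (hij : (i : ℤ) ≤ j) : extendedFVector P {(i : ℤ), j} = (facePairs P i j).ncard := by
  symm
  refine ncard_congr (fun p _ => {p.1, p.2}) ?_ ?_ ?_
  · rintro ⟨F, G⟩ ⟨hF, hG, hFG, hi, hj⟩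
    refine ⟨?_, ?_, ?_⟩
    · rintro H (rfl | rfl)
      exacts [hF, hG]
    · exact IsChain.pair hFG
    · simp only at hi hj
      rw [image_pair, hi, hj]
  · rintro ⟨F, G⟩ ⟨F', G'⟩ ⟨-, -, hFG, -⟩ ⟨-, -, hFG', -⟩ h
    simp only at hFG hFG' h
    rcases (pair_eq_pair_iff).1 h with ⟨rfl, rfl⟩ | ⟨rfl, rfl⟩
    · rfl
    · rw [hFG.antisymm hFG']
  · rintro C ⟨hface, hchain, hdim⟩
    obtain ⟨F, hFC, hFi⟩ : (i : ℤ) ∈ dim '' C := hdim ▸ Or.inl rfl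
    obtain ⟨G, hGC, hGj⟩ : j ∈ dim '' C := hdim ▸ Or.inr rfl
    have hnonneg : ∀ H ∈ C, H.Nonempty := by
      intro H hH
      have : dim H ∈ ({(i : ℤ), j} : Set ℤ) := hdim ▸ mem_image_of_mem _ hH
      have h0 : 0 ≤ dim H := by
        rcases this with h | h <;> rw [h] <;> omega
      exact nonempty_of_dim (Int.toNat_of_nonneg h0).symm
    have hunique : ∀ H ∈ C, ∀ K ∈ C, dim H = dim K → H = K := by
      intro H hH K hK h
      rcases hchain.total hH hK with hHK | hKH
      · exact eq_of_subset_of_dim_eq (hface H hH) (hface K hK) (hnonneg H hH) hHK h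
      · exact (eq_of_subset_of_dim_eq (hface K hK) (hface H hH) (hnonneg K hK) hKH h.symm).symm
    have hFG : F ⊆ G := by
      rcases hchain.total hFC hGC with h | h
      · exact h
      · have := dim_mono (hnonneg G hGC) h
        exact (hunique F hFC G hGC (by omega)).subset
    refine ⟨(F, G), ⟨hface F hFC, hface G hGC, hFG, hFi, hGj⟩, ?_⟩
    refine Subset.antisymm (pair_subset hFC hGC) fun H hH => ?_
    have : dim H ∈ ({(i : ℤ), j} : Set ℤ) := hdim ▸ mem_image_of_mem _ hH
    rcases this with h | h
    · exact Or.inl (hunique H hH F hFC (h.trans hFi.symm))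
    · exact Or.inr (hunique H hH G hGC (h.trans hGj.symm))

theorem fVector_add_dual [FiniteDimensional ℝ E] {P : Set E} (hP : IsPolytope P)
    (hne : P.Nonempty) (hd : dim P = Module.finrank ℝ E) (hc : PerfectlyCentered P) {k : ℕ}
    (hk : k < Module.finrank ℝ E) :
    fVector (P + dual P) k =
      (⋃ i ∈ Finset.range (k + 1), facePairs P i (i + Module.finrank ℝ E - 1 - k)).ncard := by
  have h0 := hc.zero_mem_interior hne hd
  have hpairs : ∀ p : Set E × Set E,
      p ∈ (⋃ i ∈ Finset.range (k + 1), facePairs P i (i + Module.finrank ℝ E - 1 - k)) →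
      IsFace P p.1 ∧ IsFace P p.2 ∧ p.1 ⊆ p.2 ∧ p.1.Nonempty ∧ p.2 ≠ P ∧
        dim p.2 = dim p.1 + Module.finrank ℝ E - 1 - k := by
    rintro ⟨F, G⟩ hp
    simp only [mem_iUnion, Finset.mem_range] at hp
    obtain ⟨i, hik, hF, hG, hFG, hi, hj⟩ := hp
    simp only at hF hG hFG hi hj ⊢
    refine ⟨hF, hG, hFG, nonempty_of_dim hi, ?_, by omega⟩
    -- For `i ≤ k` the larger face has dimension `i + d - 1 - k ≤ d - 1`, so it is proper.
    rintro rfl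
    omega
  symm
  refine ncard_congr (fun p _ => p.1 + dualFace P p.2) ?_ ?_ ?_
  · rintro ⟨F, G⟩ hp
    obtain ⟨hF, hG, hFG, hFne, hGP, hdim⟩ := hpairs _ hp
    simp only at hF hG hFG hFne hGP hdim ⊢
    obtain ⟨v, hFv, hGv⟩ := hc.exists_maxFace_eq_dualFace hP hF hFne hG hGP hFG
    obtain ⟨q, -, -, -, hq, -⟩ := hc.exists_center hG (hFne.mono hFG) hGP
    refine ⟨?_, ?_⟩
    · rw [hFv, hGv, ← maxFace_add]
      exact isFace_maxFace _ _
    · rw [dim_add_of_inner_eq hFne ⟨_, hq⟩ (fun x hx y hy => hy.2 x (hFG hx)),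
        hc.dim_dualFace hP hG (hFne.mono hFG) hGP]
      omega
  · rintro ⟨F, G⟩ ⟨F', G'⟩ hp hp' h
    obtain ⟨hF, hG, hFG, hFne, hGP, -⟩ := hpairs _ hp
    obtain ⟨hF', hG', hFG', hFne', hGP', -⟩ := hpairs _ hp'
    simp only at hF hG hFG hFne hGP hF' hG' hFG' hFne' hGP' h
    obtain ⟨v, hFv, hGv⟩ := hc.exists_maxFace_eq_dualFace hP hF hFne hG hGP hFG
    obtain ⟨w, hFw, hGw⟩ := hc.exists_maxFace_eq_dualFace hP hF' hFne' hG' hGP' hFG'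
    obtain ⟨q, -, -, -, hq, -⟩ := hc.exists_center hG (hFne.mono hFG) hGP
    obtain ⟨q', -, -, -, hq', -⟩ := hc.exists_center hG' (hFne'.mono hFG') hGP'
    obtain ⟨h1, h2⟩ := maxFace_eq_of_add_eq (P := P) (Q := dual P) (v := v) (w := w)
      (hFv ▸ hFne) (hGv ▸ nonempty_of_mem hq) (hFw ▸ hFne') (hGw ▸ nonempty_of_mem hq')
      (by rw [← hFv, ← hGv, ← hFw, ← hGw, h])
    rw [← hFv, ← hFw] at h1
    rw [← hGv, ← hGw] at h2
    rw [h1, hc.eq_of_dualFace_eq hG (hFne.mono hFG) hGP hG' (hFne'.mono hFG') hGP' h2]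
  · rintro M ⟨hM, hMk⟩
    have hMne := nonempty_of_dim hMk
    obtain ⟨v, rfl⟩ := IsFace.exists_maxFace hM hMne
    -- The zero functional exposes the whole sum, whose dimension is `d > k`.
    have hv : v ≠ 0 := by
      rintro rfl
      rw [maxFace_zero] at hMk hMne
      have htop : vectorSpan ℝ (P + dual P) = ⊤ := by
        rw [vectorSpan_add_set hne ⟨0, zero_mem_dual P⟩, vectorSpan_eq_top_of_dim hne hd, top_sup_eq]
      rw [dim_of_nonempty hMne, htop, finrank_top] at hMk
      omega
    obtain ⟨G, hG, hGP, hFG, hGv⟩ := hc.exists_maxFace_dual_eq hP h0 hv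
    rw [maxFace_add, hGv] at hMk hMne
    rw [maxFace_add, hGv]
    obtain ⟨hFne, hKne⟩ := add_nonempty.1 hMne
    have hGne := hFne.mono hFG
    rw [dim_add_of_inner_eq hFne hKne (fun x hx y hy => hy.2 x (hFG hx)),
      hc.dim_dualFace hP hG hGne hGP] at hMk
    have hKdim := hc.dim_dualFace hP hG hGne hGP
    rw [dim_of_nonempty hKne] at hKdim
    have hFdim := dim_of_nonempty hFne
    refine ⟨(maxFace P v, G), ?_, rfl⟩
    simp only [mem_iUnion, Finset.mem_range]
    refine ⟨Module.finrank ℝ (vectorSpan ℝ (maxFace P v)), ?_, isFace_maxFace P v, hG, hFG,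
      hFdim, ?_⟩
    -- The dual face is nonempty, so its dimension is nonnegative and `dim F ≤ k`.
    · omega
    · simp only
      omega

end Counting

end PerfCentered

theorem theorem7 (d : ℕ) (P : Set (EuclideanSpace ℝ (Fin d)))
    (hP : PerfCentered.IsPolytope P) (hd : PerfCentered.dim P = d)
    (hc : PerfCentered.PerfectlyCentered P) (k : ℕ) (hk : k < d) :
    PerfCentered.fVector (P + PerfCentered.dual P) k =
      ∑ i ∈ Finset.range (k + 1),
        PerfCentered.extendedFVector P {(i : ℤ), (i : ℤ) + d - 1 - k} := by
  have hfr : Module.finrank ℝ (EuclideanSpace ℝ (Fin d)) = d := finrank_euclideanSpace_fin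
  have h := PerfCentered.fVector_add_dual hP (PerfCentered.nonempty_of_dim hd)
    (hd.trans (by rw [hfr])) hc (k := k) (by rwa [hfr])
  rw [hfr] at h
  -- The dimension of the smaller face recovers the index `i`.
  have hdisj : ((Finset.range (k + 1) : Finset ℕ) : Set ℕ).PairwiseDisjoint
      fun i : ℕ => PerfCentered.facePairs P i (i + d - 1 - k) := by
    intro i _ j _ hij
    refine Set.disjoint_left.2 fun p hp hp' => hij ?_
    exact_mod_cast hp.2.2.2.1.symm.trans hp'.2.2.2.1
  have hunion := Set.Finite.ncard_biUnion (Finset.range (k + 1)).finite_toSet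
    (fun i _ => hP.finite_facePairs (i : ℕ) (i + d - 1 - k)) hdisj
  rw [finsum_mem_coe_finset] at hunion
  simp only [Finset.mem_coe] at hunion
  rw [h, hunion]
  refine Finset.sum_congr rfl fun i _ => ?_
  rw [PerfCentered.extendedFVector_pair P i (by omega)]
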